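/- **Theorem.** For $x\in\mathbb R$ let $$M(x)=\begin{pmatrix}1+x&1+x\\ 1&2+x\end{pmatrix},\qquad \mathcal M(x_1,\dots,x_n)=M(x_1)M(x_2)\cdots M(x_n).$$ Let $x_1,x_2,\dots$ be i.i.d. real random variables on a probability space, with a law supported on $[1/2,1]$. Let $\lambda_+$ and $\lambda_-$ denote the largest and the smallest eigenvalue of $\mathcal M(x_1,\dots,x_n)$; almost surely, for all $n$, these are real and positive, so that $$Y_n=\frac1n\log\frac{\lambda_+(\mathcal M(x_1,\dots,x_n))}{\lambda_-(\mathcal M(x_1,\dots,x_n))}\qquad(n\ge1)$$ is well defined, and $Y_n$ is integrable. Then the following hold. 1. (Concentration.) There is a constant $C>0$ such that for all $n\ge1$ and all $\varepsilon>0$ $$\mathbb P\big(Y_n-\mathbb E(Y_n)>\varepsilon\big)\le e^{-C\varepsilon^2n}\quad\text{and}\quad \mathbb P\big(Y_n-\mathbb E(Y_n)<-\varepsilon\big)\le e^{-C\varepsilon^2n}.$$ 2. There are (deterministic) real constants $L_+$ and $L_-$ such that, almost surely, $$\lim_{n\to\infty}\frac1n\log\lambda_\pm(\mathcal M(x_1,\dots,x_n))=L_\pm,$$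 and $L_++L_-=2\,\mathbb E\log(1+x_1)$. 3. Almost surely $\lim_{n\to\infty}Y_n=L_+-L_-$; moreover $\lim_{n\to\infty}\mathbb E(Y_n)=L_+-L_-$, and $$L_+-L_-\le\log\frac{\Lambda_+(\gamma)}{\Lambda_-(\gamma)},\qquad \gamma=\big(\mathbb E[(1+x_1)^{-1}]\big)^{-1}\in[3/2,2],$$ where $\Lambda_\pm(\gamma)=\frac{2\gamma+1\pm\sqrt{4\gamma+1}}2$ are the eigenvalues of $\begin{pmatrix}\gamma&\gamma\\1&1+\gamma\end{pmatrix}$. -/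

import Mathlib

open MeasureTheory ProbabilityTheory Filter Topology

noncomputable section

namespace TransferMatrix

/-- The one-step transfer matrix `M(x)`. -/
def M (x : ℝ) : Matrix (Fin 2) (Fin 2) ℝ :=
  !![1 + x, 1 + x; 1, 2 + x]

/-- The ordered product `M(x 0) * M(x 1) * ⋯ * M(x (n - 1))`; the term `x i` of the sequence
stands for the variable usually written `x_{i+1}`. -/
def prodM (x : ℕ → ℝ) (n : ℕ) : Matrix (Fin 2) (Fin 2) ℝ :=
  ((List.range n).map fun i => M (x i)).prod

/-- The largest real eigenvalue of a real matrix. -/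
def eigMax (A : Matrix (Fin 2) (Fin 2) ℝ) : ℝ := sSup (spectrum ℝ A)

/-- The smallest real eigenvalue of a real matrix. -/
def eigMin (A : Matrix (Fin 2) (Fin 2) ℝ) : ℝ := sInf (spectrum ℝ A)

/-- `Y_n = (1/n) log (λ₊ / λ₋)` for the product of the first `n` matrices. -/
def Y (x : ℕ → ℝ) (n : ℕ) : ℝ :=
  (1 / (n : ℝ)) * Real.log (eigMax (prodM x n) / eigMin (prodM x n))

/-- `Λ₊(γ)`, the larger eigenvalue of the matrix with rows `(γ, γ)` and `(1, 1 + γ)`. -/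
def LambdaPlus (γ : ℝ) : ℝ := (2 * γ + 1 + Real.sqrt (4 * γ + 1)) / 2

/-- `Λ₋(γ)`, the smaller eigenvalue of the matrix with rows `(γ, γ)` and `(1, 1 + γ)`. -/
def LambdaMinus (γ : ℝ) : ℝ := (2 * γ + 1 - Real.sqrt (4 * γ + 1)) / 2

end TransferMatrix

end

/-!
Dividing `M x` by `1 + x` gives matrices of determinant one, any two rows of which are entrywise
comparable up to a constant `K`. The eigenvalues of a product of such matrices are the Perron root
`ρ` and `ρ⁻¹`, so that `n * Y_n = 2 * log ρ`, and since the Perron root is monotone in the entries,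
changing one factor changes `log ρ` by at most `log K`; concentration is then McDiarmid's
inequality. Up to a constant factor `ρ` equals the sum of the entries, which is submultiplicative,
so `E Y_n` converges by Fekete's lemma, and concentration together with Borel–Cantelli upgrades
this to almost sure convergence of `Y_n`. The strong law of large numbers for `∏ (1 + x i)` turns
it into the limits of both eigenvalues. Finally, the expectation of a product of independent
matrices is the power of their mean matrix, and Jensen's inequality bounds the growth rate of
`E log ρ` by the logarithm of the Perron root of the mean matrix; `M x / (1 + x)` is affine in
`(1 + x)⁻¹`, hence that matrix is `M (γ - 1) / γ` with `γ = (E (1 + x)⁻¹)⁻¹`.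
-/

namespace TransferMatrix

open scoped NNReal Pointwise

section BoundedDifferences

/-- Changing the `i`-th argument of `f` alone changes its value by at most `c i`: the hypothesis
of McDiarmid's inequality. -/
def HasBoundedDifferences {ι : Type*} [DecidableEq ι] {E : ι → Type*} (f : (∀ i, E i) → ℝ)
    (c : ι → ℝ≥0) : Prop :=
  ∀ x i y, |f (Function.update x i y) - f x| ≤ c i

theorem HasBoundedDifferences.abs_sub_le_sum {ι : Type*} [DecidableEq ι] [Fintype ι]
    {E : ι → Type*} {f : (∀ i, E i) → ℝ} {c : ι → ℝ≥0} (hf : HasBoundedDifferences f c)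
    (x y : ∀ i, E i) : |f y - f x| ≤ ∑ i, c i := by
  have interpolate (s : Finset ι) : |f (s.piecewise y x) - f x| ≤ ∑ i ∈ s, (c i : ℝ) := by
    induction s using Finset.induction_on with
    | empty => simp
    | insert j s hj ih =>
      rw [Finset.piecewise_insert, Finset.sum_insert hj]
      exact (abs_sub_le _ _ _).trans (add_le_add (hf _ j (y j)) ih)
  simpa using interpolate Finset.univ

theorem integrable_of_forall_abs_sub_le {E : Type*} [MeasurableSpace E] {μ : Measure E}
    [IsFiniteMeasure μ] {f : E → ℝ} (hf : AEStronglyMeasurable f μ) {c : ℝ}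
    (h : ∀ x y, |f x - f y| ≤ c) : Integrable f μ := by
  obtain hE | ⟨⟨x₀⟩⟩ := isEmpty_or_nonempty E
  · exact .of_isEmpty
  refine .of_bound hf (|f x₀| + c) (.of_forall fun x => ?_)
  rw [Real.norm_eq_abs]
  linarith [abs_sub_abs_le_abs_sub (f x) (f x₀), h x x₀]

theorem hasSubgaussianMGF_of_forall_abs_sub_le {E : Type*} [MeasurableSpace E] {μ : Measure E}
    [IsProbabilityMeasure μ] {f : E → ℝ} (hf : AEMeasurable f μ) {c : ℝ≥0}
    (h : ∀ x y, |f x - f y| ≤ c) :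
    HasSubgaussianMGF (fun x => f x - ∫ y, f y ∂μ) (c ^ 2 / 4) μ := by
  have : Nonempty E := μ.nonempty_of_neZero
  have hbdd : BddBelow (Set.range f) :=
    let ⟨x₀⟩ := this
    ⟨f x₀ - c, by rintro _ ⟨y, rfl⟩; linarith [le_abs_self (f x₀ - f y), h x₀ y]⟩
  have hmem (x : E) : f x ∈ Set.Icc (⨅ y, f y) ((⨅ y, f y) + c) := by
    refine ⟨ciInf_le hbdd x, ?_⟩
    rw [← sub_le_iff_le_add]
    exact le_ciInf fun y => by linarith [le_abs_self (f x - f y), h x y]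
  convert hasSubgaussianMGF_of_mem_Icc hf (.of_forall hmem) using 1
  rw [add_sub_cancel_left, div_pow, Real.nnnorm_of_nonneg c.coe_nonneg]
  norm_num

theorem integrable_exp_mul_of_hasSubgaussianMGF_sub_const {E : Type*} [MeasurableSpace E]
    {μ : Measure E} {f : E → ℝ} {m : ℝ} {c : ℝ≥0}
    (h : HasSubgaussianMGF (fun x => f x - m) c μ) (t : ℝ) :
    Integrable (fun x => Real.exp (t * f x)) μ := by
  refine ((h.integrable_exp_mul t).const_mul (Real.exp (t * m))).congr (.of_forall fun x => ?_)
  simp only [← Real.exp_add]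
  ring_nf

theorem mgf_le_of_hasSubgaussianMGF_sub_const {E : Type*} [MeasurableSpace E]
    {μ : Measure E} {f : E → ℝ} {m : ℝ} {c : ℝ≥0}
    (h : HasSubgaussianMGF (fun x => f x - m) c μ) (t : ℝ) :
    mgf f μ t ≤ Real.exp (t * m) * Real.exp (c * t ^ 2 / 2) := by
  have hshift : mgf f μ t = Real.exp (t * m) * mgf (fun x => f x - m) μ t := by
    rw [mgf, mgf, ← integral_const_mul]
    congr with x
    rw [← Real.exp_add]
    ring_nf
  rw [hshift]
  gcongr
  exact h.mgf_le t

section Prod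

variable {E F : Type*} [MeasurableSpace E] [MeasurableSpace F] {μ : Measure E} {ν : Measure F}
  [SFinite μ] [SFinite ν] {f : E × F → ℝ} {g : F → ℝ} {c d : ℝ≥0}

theorem integrable_exp_mul_prod_of_sections (hf : AEStronglyMeasurable f (μ.prod ν))
    (hsection : ∀ y, HasSubgaussianMGF (fun x => f (x, y) - g y) c μ)
    (hg : HasSubgaussianMGF g d ν) (t : ℝ) :
    Integrable (fun p => Real.exp (t * f p)) (μ.prod ν) := by
  have hmeas : AEStronglyMeasurable (fun p => Real.exp (t * f p)) (μ.prod ν) :=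
    Real.continuous_exp.comp_aestronglyMeasurable (hf.const_mul t)
  refine (integrable_prod_iff' hmeas).2
    ⟨.of_forall fun y => integrable_exp_mul_of_hasSubgaussianMGF_sub_const (hsection y) t, ?_⟩
  refine ((hg.integrable_exp_mul t).mul_const (Real.exp (c * t ^ 2 / 2))).mono'
    hmeas.norm.prod_swap.integral_prod_right' (.of_forall fun y => ?_)
  simp only [Real.norm_eq_abs, Real.abs_exp]
  rw [abs_of_nonneg (by positivity)]
  exact mgf_le_of_hasSubgaussianMGF_sub_const (hsection y) t

theorem hasSubgaussianMGF_prod_of_sections (hf : AEStronglyMeasurable f (μ.prod ν))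
    (hsection : ∀ y, HasSubgaussianMGF (fun x => f (x, y) - g y) c μ)
    (hg : HasSubgaussianMGF g d ν) : HasSubgaussianMGF f (c + d) (μ.prod ν) := by
  have hint := integrable_exp_mul_prod_of_sections hf hsection hg
  refine ⟨hint, fun t => ?_⟩
  calc mgf f (μ.prod ν) t = ∫ y, mgf (fun x => f (x, y)) μ t ∂ν := integral_prod_symm _ (hint t)
    _ ≤ ∫ y, Real.exp (t * g y) * Real.exp (c * t ^ 2 / 2) ∂ν :=
        integral_mono (hint t).integral_prod_right ((hg.integrable_exp_mul t).mul_const _)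
          fun y => mgf_le_of_hasSubgaussianMGF_sub_const (hsection y) t
    _ = mgf g ν t * Real.exp (c * t ^ 2 / 2) := integral_mul_const _ _
    _ ≤ Real.exp (d * t ^ 2 / 2) * Real.exp (c * t ^ 2 / 2) := by
        gcongr
        exact hg.mgf_le t
    _ = Real.exp ((c + d : ℝ≥0) * t ^ 2 / 2) := by
        rw [← Real.exp_add, NNReal.coe_add]
        ring_nf

end Prod

section Cons

variable {n : ℕ} {E : Fin (n + 1) → Type*} {f : (∀ i, E i) → ℝ} {c : Fin (n + 1) → ℝ≥0}

theorem HasBoundedDifferences.abs_cons_sub_cons_le (hf : HasBoundedDifferences f c) (x x' : E 0)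
    (y : ∀ i : Fin n, E i.succ) : |f (Fin.cons x y) - f (Fin.cons x' y)| ≤ c 0 := by
  simpa using hf (Fin.cons x' y) 0 x

variable [∀ i, MeasurableSpace (E i)] {μ : ∀ i, Measure (E i)}

theorem measurable_finCons :
    Measurable fun p : E 0 × (∀ i : Fin n, E i.succ) => (Fin.cons p.1 p.2 : ∀ i, E i) :=
  measurable_pi_iff.2 <|
    Fin.cases measurable_fst fun i => (measurable_pi_apply i).comp measurable_snd

theorem measurePreserving_finUncons [∀ i, SigmaFinite (μ i)] :
    MeasurePreserving (fun x : ∀ i, E i => (x 0, Fin.tail x)) (Measure.pi μ)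
      ((μ 0).prod (Measure.pi fun i => μ i.succ)) :=
  measurePreserving_piFinSuccAbove μ 0

theorem integral_pi_finUncons [∀ i, SigmaFinite (μ i)] (F : E 0 × (∀ i : Fin n, E i.succ) → ℝ) :
    ∫ x, F (x 0, Fin.tail x) ∂Measure.pi μ
      = ∫ p, F p ∂(μ 0).prod (Measure.pi fun i => μ i.succ) :=
  measurePreserving_finUncons.integral_comp
    (MeasurableEquiv.piFinSuccAbove E 0).measurableEmbedding F

variable [∀ i, IsProbabilityMeasure (μ i)]

theorem HasBoundedDifferences.integrable_cons (hf : HasBoundedDifferences f c) (hfm : Measurable f)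
    (y : ∀ i : Fin n, E i.succ) : Integrable (fun x => f (Fin.cons x y)) (μ 0) := by
  have hmeas : Measurable fun x => f (Fin.cons x y) :=
    hfm.comp (measurable_finCons.comp measurable_prodMk_right)
  exact integrable_of_forall_abs_sub_le hmeas.aestronglyMeasurable
    fun x x' => hf.abs_cons_sub_cons_le x x' y

theorem HasBoundedDifferences.integral_cons (hf : HasBoundedDifferences f c) (hfm : Measurable f) :
    HasBoundedDifferences (fun y : ∀ i : Fin n, E i.succ => ∫ x, f (Fin.cons x y) ∂μ 0)
      (Fin.tail c) := by
  intro y i z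
  rw [← integral_sub (hf.integrable_cons hfm _) (hf.integrable_cons hfm _), ← Real.norm_eq_abs]
  refine (norm_integral_le_of_norm_le_const (.of_forall fun x => ?_)).trans_eq
    (by rw [probReal_univ, mul_one])
  have := hf (Fin.cons x y) i.succ z
  rwa [← Fin.cons_update] at this

end Cons

/-- **McDiarmid's inequality**, in its moment generating function form. -/
theorem HasBoundedDifferences.hasSubgaussianMGF {n : ℕ} {E : Fin n → Type*}
    [∀ i, MeasurableSpace (E i)] {μ : ∀ i, Measure (E i)} [∀ i, IsProbabilityMeasure (μ i)]
    {f : (∀ i, E i) → ℝ} {c : Fin n → ℝ≥0} (hf : HasBoundedDifferences f c) (hfm : Measurable f) :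
    HasSubgaussianMGF (fun x => f x - ∫ y, f y ∂Measure.pi μ) ((∑ i, c i ^ 2) / 4)
      (Measure.pi μ) := by
  induction n with
  | zero =>
    have hconst (x : ∀ i, E i) : f x - ∫ y, f y ∂Measure.pi μ = 0 := by
      rw [integral_congr_ae (.of_forall fun y => congrArg f (Subsingleton.elim y x)),
        integral_const, probReal_univ, one_smul, sub_self]
    simp only [hconst, Finset.univ_eq_empty, Finset.sum_empty, zero_div]
    exact .fun_zero
  | succ n ih =>
    have hmeas := hfm.comp measurable_finCons
    have hfubini : ∫ y, f y ∂Measure.pi μ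
        = ∫ y, ∫ x, f (Fin.cons x y) ∂μ 0 ∂Measure.pi fun i => μ i.succ := by
      have hint : Integrable (fun p => f (Fin.cons p.1 p.2))
          ((μ 0).prod (Measure.pi fun i => μ i.succ)) :=
        integrable_of_forall_abs_sub_le hmeas.aestronglyMeasurable
          fun p q => hf.abs_sub_le_sum (Fin.cons q.1 q.2) (Fin.cons p.1 p.2)
      rw [← integral_prod_symm _ hint, ← integral_pi_finUncons]
      simp only [Fin.cons_self_tail]
    set m := ∫ y, f y ∂Measure.pi μ
    have hsection (y : ∀ i : Fin n, E i.succ) :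
        HasSubgaussianMGF (fun x => f (Fin.cons x y) - m - (∫ x, f (Fin.cons x y) ∂μ 0 - m))
          (c 0 ^ 2 / 4) (μ 0) := by
      simpa only [sub_sub_sub_cancel_right] using hasSubgaussianMGF_of_forall_abs_sub_le
        (hf.integrable_cons hfm y).aemeasurable fun x x' => hf.abs_cons_sub_cons_le x x' y
    have htail := ih (μ := fun i => μ i.succ) (hf.integral_cons (μ := μ) hfm)
      hmeas.stronglyMeasurable.integral_prod_left'.measurable
    rw [← hfubini] at htail
    have hprod := hasSubgaussianMGF_prod_of_sections
      (hmeas.sub_const m).aestronglyMeasurable hsection htail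
    rw [← measurePreserving_finUncons.map_eq] at hprod
    simpa only [Function.comp_def, Fin.cons_self_tail, Fin.sum_univ_succ, add_div, Fin.tail]
      using hprod.of_map measurePreserving_finUncons.aemeasurable

end BoundedDifferences

section Spectrum

variable {A B : Matrix (Fin 2) (Fin 2) ℝ}

theorem spectrum_eq_pair (hA : 4 * A.det ≤ A.trace ^ 2) :
    spectrum ℝ A = {(A.trace - √(A.trace ^ 2 - 4 * A.det)) / 2,
      (A.trace + √(A.trace ^ 2 - 4 * A.det)) / 2} := by
  have hsq := Real.sq_sqrt (sub_nonneg.2 hA)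
  ext r
  have hfactor : r ^ 2 - A.trace * r + A.det
      = (r - (A.trace - √(A.trace ^ 2 - 4 * A.det)) / 2)
        * (r - (A.trace + √(A.trace ^ 2 - 4 * A.det)) / 2) := by
    linear_combination hsq / 4
  rw [Matrix.mem_spectrum_iff_isRoot_charpoly, Matrix.charpoly_fin_two, Polynomial.IsRoot.def]
  simp only [Polynomial.eval_add, Polynomial.eval_sub, Polynomial.eval_mul, Polynomial.eval_pow,
    Polynomial.eval_X, Polynomial.eval_C]
  rw [hfactor, mul_eq_zero, sub_eq_zero, sub_eq_zero, Set.mem_insert_iff, Set.mem_singleton_iff]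

theorem eigMax_eq (hA : 4 * A.det ≤ A.trace ^ 2) :
    eigMax A = (A.trace + √(A.trace ^ 2 - 4 * A.det)) / 2 := by
  rw [eigMax, spectrum_eq_pair hA, csSup_pair, max_eq_right]
  linarith [Real.sqrt_nonneg (A.trace ^ 2 - 4 * A.det)]

theorem eigMin_eq (hA : 4 * A.det ≤ A.trace ^ 2) :
    eigMin A = (A.trace - √(A.trace ^ 2 - 4 * A.det)) / 2 := by
  rw [eigMin, spectrum_eq_pair hA, csInf_pair, min_eq_left]
  linarith [Real.sqrt_nonneg (A.trace ^ 2 - 4 * A.det)]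

theorem spectrum_eq_eigMin_eigMax (hA : 4 * A.det ≤ A.trace ^ 2) :
    spectrum ℝ A = {eigMin A, eigMax A} := by
  rw [spectrum_eq_pair hA, eigMin_eq hA, eigMax_eq hA]

theorem eigMin_le_eigMax (hA : 4 * A.det ≤ A.trace ^ 2) : eigMin A ≤ eigMax A := by
  rw [eigMin_eq hA, eigMax_eq hA]
  linarith [Real.sqrt_nonneg (A.trace ^ 2 - 4 * A.det)]

theorem isGreatest_eigMax (hA : 4 * A.det ≤ A.trace ^ 2) :
    IsGreatest (spectrum ℝ A) (eigMax A) := by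
  simpa only [spectrum_eq_eigMin_eigMax hA, max_eq_right (eigMin_le_eigMax hA)]
    using isGreatest_pair (a := eigMin A) (b := eigMax A)

theorem isLeast_eigMin (hA : 4 * A.det ≤ A.trace ^ 2) : IsLeast (spectrum ℝ A) (eigMin A) := by
  simpa only [spectrum_eq_eigMin_eigMax hA, min_eq_left (eigMin_le_eigMax hA)]
    using isLeast_pair (a := eigMin A) (b := eigMax A)

theorem eigMax_add_eigMin (hA : 4 * A.det ≤ A.trace ^ 2) : eigMax A + eigMin A = A.trace := by
  rw [eigMin_eq hA, eigMax_eq hA]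
  ring

theorem eigMax_mul_eigMin (hA : 4 * A.det ≤ A.trace ^ 2) : eigMax A * eigMin A = A.det := by
  rw [eigMin_eq hA, eigMax_eq hA]
  linear_combination -Real.sq_sqrt (sub_nonneg.2 hA) / 4

theorem eigMax_smul {d : ℝ} (hd : 0 < d) (A : Matrix (Fin 2) (Fin 2) ℝ) :
    eigMax (d • A) = d * eigMax A := by
  have hspec : spectrum ℝ (d • A) = d • spectrum ℝ A :=
    spectrum.unit_smul_eq_smul A (Units.mk0 d hd.ne')
  rw [eigMax, hspec, Real.sSup_smul_of_nonneg hd.le, smul_eq_mul, eigMax]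

theorem eigMin_smul {d : ℝ} (hd : 0 < d) (A : Matrix (Fin 2) (Fin 2) ℝ) :
    eigMin (d • A) = d * eigMin A := by
  have hspec : spectrum ℝ (d • A) = d • spectrum ℝ A :=
    spectrum.unit_smul_eq_smul A (Units.mk0 d hd.ne')
  rw [eigMin, hspec, Real.sInf_smul_of_nonneg hd.le, smul_eq_mul, eigMin]

theorem trace_pow_fin_two (hA : 4 * A.det ≤ A.trace ^ 2) (n : ℕ) :
    (A ^ n).trace = eigMax A ^ n + eigMin A ^ n := by
  have hsum := eigMax_add_eigMin hA
  have hmul := eigMax_mul_eigMin hA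
  have cayley_hamilton : A ^ 2 = A.trace • A - A.det • 1 := by
    have h := A.aeval_self_charpoly
    simp only [Matrix.charpoly_fin_two, map_add, map_sub, map_mul, map_pow, Polynomial.aeval_X,
      Polynomial.aeval_C, Algebra.algebraMap_eq_smul_one, smul_one_mul] at h
    rw [sub_add_eq_add_sub, sub_eq_zero] at h
    exact eq_sub_of_add_eq h
  have hrec (k : ℕ) :
      (A ^ (k + 2)).trace = A.trace * (A ^ (k + 1)).trace - A.det * (A ^ k).trace := by
    rw [pow_add, cayley_hamilton, mul_sub, Matrix.mul_smul, Matrix.mul_smul, ← pow_succ, mul_one,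
      Matrix.trace_sub, Matrix.trace_smul, Matrix.trace_smul, smul_eq_mul, smul_eq_mul]
  induction n using Nat.twoStepInduction with
  | zero => norm_num
  | one => simp [hsum]
  | more k ih₀ ih₁ =>
    rw [hrec, ih₀, ih₁, ← hsum, ← hmul]
    ring

section Nonneg

theorem four_mul_det_le_trace_sq (hA : ∀ i j, 0 ≤ A i j) : 4 * A.det ≤ A.trace ^ 2 := by
  rw [Matrix.det_fin_two, Matrix.trace_fin_two]
  nlinarith [sq_nonneg (A 0 0 - A 1 1), mul_nonneg (hA 0 1) (hA 1 0)]

theorem trace_nonneg_of_nonneg (hA : ∀ i j, 0 ≤ A i j) : 0 ≤ A.trace :=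
  Finset.sum_nonneg fun i _ => hA i i

theorem trace_pow_le_two_mul_eigMax_pow (hA : ∀ i j, 0 ≤ A i j) (n : ℕ) :
    (A ^ n).trace ≤ 2 * eigMax A ^ n := by
  have hdisc := four_mul_det_le_trace_sq hA
  have habs : |eigMin A| ≤ eigMax A :=
    abs_le.2 ⟨by linarith [eigMax_add_eigMin hdisc, trace_nonneg_of_nonneg hA],
      eigMin_le_eigMax hdisc⟩
  have hpow : eigMin A ^ n ≤ eigMax A ^ n :=
    (le_abs_self _).trans (by rw [abs_pow]; gcongr)
  linarith [trace_pow_fin_two hdisc n]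

theorem eigMax_le_of_mul_le {r : ℝ} (hA : 4 * A.det ≤ A.trace ^ 2) (h₀ : A 0 0 ≤ r) (h₁ : A 1 1 ≤ r)
    (h : A 0 1 * A 1 0 ≤ (r - A 0 0) * (r - A 1 1)) : eigMax A ≤ r := by
  have hsqrt : √(A.trace ^ 2 - 4 * A.det) ≤ 2 * r - A.trace := by
    rw [Matrix.det_fin_two, Matrix.trace_fin_two]
    exact Real.sqrt_le_iff.2 ⟨by linarith, by nlinarith⟩
  rw [eigMax_eq hA]
  linarith

theorem diag_le_eigMax (hA : ∀ i j, 0 ≤ A i j) (i : Fin 2) : A i i ≤ eigMax A := by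
  have hsqrt : |A 0 0 - A 1 1| ≤ √(A.trace ^ 2 - 4 * A.det) := by
    apply Real.abs_le_sqrt
    rw [Matrix.det_fin_two, Matrix.trace_fin_two]
    nlinarith [mul_nonneg (hA 0 1) (hA 1 0)]
  rw [eigMax_eq (four_mul_det_le_trace_sq hA), Matrix.trace_fin_two]
  rw [Matrix.trace_fin_two] at hsqrt
  fin_cases i <;> dsimp <;> linarith [abs_le.1 hsqrt]

theorem eigMax_sub_mul_eigMax_sub (hA : 4 * A.det ≤ A.trace ^ 2) :
    (eigMax A - A 0 0) * (eigMax A - A 1 1) = A 0 1 * A 1 0 := by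
  have hsum := eigMax_add_eigMin hA
  have hmul := eigMax_mul_eigMin hA
  rw [Matrix.trace_fin_two] at hsum
  rw [Matrix.det_fin_two] at hmul
  linear_combination eigMax A * hsum - hmul

theorem eigMax_mono (hA : ∀ i j, 0 ≤ A i j) (h : ∀ i j, A i j ≤ B i j) : eigMax A ≤ eigMax B := by
  have hB : ∀ i j, 0 ≤ B i j := fun i j => (hA i j).trans (h i j)
  refine eigMax_le_of_mul_le (four_mul_det_le_trace_sq hA)
    ((h 0 0).trans (diag_le_eigMax hB 0)) ((h 1 1).trans (diag_le_eigMax hB 1)) ?_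
  calc A 0 1 * A 1 0 ≤ B 0 1 * B 1 0 := mul_le_mul (h 0 1) (h 1 0) (hA 1 0) (hB 0 1)
    _ = (eigMax B - B 0 0) * (eigMax B - B 1 1) :=
        (eigMax_sub_mul_eigMax_sub (four_mul_det_le_trace_sq hB)).symm
    _ ≤ (eigMax B - A 0 0) * (eigMax B - A 1 1) :=
        mul_le_mul (by linarith [h 0 0]) (by linarith [h 1 1])
          (sub_nonneg.2 (diag_le_eigMax hB 1))
          (sub_nonneg.2 ((h 0 0).trans (diag_le_eigMax hB 0)))

theorem eigMin_pos (hA : ∀ i j, 0 ≤ A i j) (hdet : 0 < A.det) : 0 < eigMin A := by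
  have hdisc := four_mul_det_le_trace_sq hA
  have hmul := eigMax_mul_eigMin hdisc
  have hmax : 0 ≤ eigMax A := (hA 0 0).trans (diag_le_eigMax hA 0)
  exact pos_of_mul_pos_right (hmul ▸ hdet) hmax

end Nonneg

section DetOne

variable (hA : ∀ i j, 0 ≤ A i j) (hdet : A.det = 1)
include hA hdet

theorem eigMin_eq_inv_eigMax : eigMin A = (eigMax A)⁻¹ :=
  eq_inv_of_mul_eq_one_right ((eigMax_mul_eigMin (four_mul_det_le_trace_sq hA)).trans hdet)

theorem one_le_eigMax : 1 ≤ eigMax A := by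
  have hdisc := four_mul_det_le_trace_sq hA
  have hmin := eigMin_pos hA (hdet ▸ one_pos)
  nlinarith [eigMin_le_eigMax hdisc, eigMax_mul_eigMin hdisc]

theorem log_eigMax_smul {d : ℝ} (hd : 0 < d) :
    Real.log (eigMax (d • A)) = Real.log d + Real.log (eigMax A) := by
  rw [eigMax_smul hd, Real.log_mul hd.ne' (zero_lt_one.trans_le (one_le_eigMax hA hdet)).ne']

theorem log_eigMin_smul {d : ℝ} (hd : 0 < d) :
    Real.log (eigMin (d • A)) = Real.log d - Real.log (eigMax A) := by
  rw [eigMin_smul hd, Real.log_mul hd.ne' (eigMin_pos hA (hdet ▸ one_pos)).ne',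
    eigMin_eq_inv_eigMax hA hdet, Real.log_inv, sub_eq_add_neg]

theorem log_eigMax_div_eigMin_smul {d : ℝ} (hd : 0 < d) :
    Real.log (eigMax (d • A) / eigMin (d • A)) = 2 * Real.log (eigMax A) := by
  rw [eigMax_smul hd, eigMin_smul hd, mul_div_mul_left _ _ hd.ne', eigMin_eq_inv_eigMax hA hdet,
    div_inv_eq_mul, ← sq, Real.log_pow, Nat.cast_ofNat]

end DetOne

end Spectrum

section EntrySum

variable {ι κ ι' : Type*}

theorem mul_apply_nonneg [Fintype κ] {A : Matrix ι κ ℝ} {B : Matrix κ ι' ℝ}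
    (hA : ∀ i j, 0 ≤ A i j) (hB : ∀ i j, 0 ≤ B i j) (i : ι) (j : ι') : 0 ≤ (A * B) i j :=
  Finset.sum_nonneg fun k _ => mul_nonneg (hA i k) (hB k j)

theorem list_prod_apply_nonneg [Fintype ι] [DecidableEq ι] {l : List (Matrix ι ι ℝ)}
    (hl : ∀ A ∈ l, ∀ i j, 0 ≤ A i j) : ∀ i j, 0 ≤ l.prod i j := by
  induction l with
  | nil =>
    intro i j
    rw [List.prod_nil, Matrix.one_apply]
    positivity
  | cons A l ih =>
    rw [List.forall_mem_cons] at hl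
    rw [List.prod_cons]
    exact mul_apply_nonneg hl.1 (ih hl.2)

/-- Any two rows of `A` are comparable up to the factor `K`. -/
def RowsComparable (K : ℝ) (A : Matrix ι κ ℝ) : Prop :=
  ∀ i i' j, A i j ≤ K * A i' j

theorem RowsComparable.mul [Fintype κ] {K : ℝ} {A : Matrix ι κ ℝ} (hA : RowsComparable K A)
    {B : Matrix κ ι' ℝ} (hB : ∀ i j, 0 ≤ B i j) : RowsComparable K (A * B) := by
  intro i i' j
  rw [Matrix.mul_apply, Matrix.mul_apply, Finset.mul_sum]
  refine Finset.sum_le_sum fun k _ => ?_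
  rw [← mul_assoc]
  exact mul_le_mul_of_nonneg_right (hA i i' k) (hB k j)

/-- The sum of the entries of a matrix. On nonnegative matrices it is submultiplicative, and it
stands in for the Perron root, to which it is comparable in the cases considered here. -/
def entrySum [Fintype ι] [Fintype κ] (A : Matrix ι κ ℝ) : ℝ :=
  ∑ i, ∑ j, A i j

variable [Fintype ι] [Fintype κ]

theorem entrySum_mul_le [Fintype ι'] {A : Matrix ι κ ℝ} {B : Matrix κ ι' ℝ}
    (hA : ∀ i j, 0 ≤ A i j) (hB : ∀ i j, 0 ≤ B i j) :
    entrySum (A * B) ≤ entrySum A * entrySum B := by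
  have hrow (k : κ) : ∑ j, B k j ≤ entrySum B :=
    Finset.single_le_sum (f := fun k => ∑ j, B k j)
      (fun k _ => Finset.sum_nonneg fun j _ => hB k j) (Finset.mem_univ k)
  calc entrySum (A * B) = ∑ i, ∑ k, A i k * ∑ j, B k j := by
        simp only [entrySum, Matrix.mul_apply, Finset.mul_sum]
        exact Finset.sum_congr rfl fun i _ => Finset.sum_comm
    _ ≤ ∑ i, ∑ k, A i k * entrySum B := by
        gcongr with i _ k _
        exacts [hA i k, hrow k]
    _ = entrySum A * entrySum B := by simp only [entrySum, Finset.sum_mul]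

theorem RowsComparable.entrySum_le {K : ℝ} {A : Matrix ι ι ℝ} (hA : RowsComparable K A) :
    entrySum A ≤ Fintype.card ι * (K * A.trace) := by
  calc entrySum A ≤ ∑ _i : ι, ∑ j, K * A j j :=
        Finset.sum_le_sum fun i _ => Finset.sum_le_sum fun j _ => hA i j j
    _ = Fintype.card ι * (K * A.trace) := by
        rw [Finset.sum_const, Finset.card_univ, nsmul_eq_mul, ← Finset.mul_sum]
        rfl

theorem entrySum_list_prod_le [DecidableEq ι] {K : ℝ} (hK : 1 ≤ K) {l : List (Matrix ι ι ℝ)}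
    (hnonneg : ∀ A ∈ l, ∀ i j, 0 ≤ A i j) (hrows : ∀ A ∈ l, RowsComparable K A) :
    entrySum l.prod ≤ Fintype.card ι * (K * l.prod.trace) := by
  cases l with
  | nil =>
    have hcard : (Fintype.card ι : ℝ) ≤ Fintype.card ι * (K * Fintype.card ι) := by
      obtain h | h := (Fintype.card ι).eq_zero_or_pos
      · simp [h]
      · have : (1 : ℝ) ≤ Fintype.card ι := mod_cast h
        exact le_mul_of_one_le_right (by positivity) (one_le_mul_of_one_le_of_one_le hK this)
    simpa [entrySum, Matrix.one_apply, Matrix.trace_one] using hcard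
  | cons A l =>
    rw [List.forall_mem_cons] at hnonneg hrows
    rw [List.prod_cons]
    exact (hrows.1.mul (list_prod_apply_nonneg hnonneg.2)).entrySum_le

theorem eigMax_le_entrySum {A : Matrix (Fin 2) (Fin 2) ℝ} (hA : ∀ i j, 0 ≤ A i j) :
    eigMax A ≤ entrySum A := by
  have hsum : entrySum A = A 0 0 + A 0 1 + (A 1 0 + A 1 1) := by simp [entrySum]
  rw [hsum]
  refine eigMax_le_of_mul_le (four_mul_det_le_trace_sq hA) ?_ ?_ ?_
  · linarith [hA 0 1, hA 1 0, hA 1 1]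
  · linarith [hA 0 0, hA 0 1, hA 1 0]
  · apply mul_le_mul <;> linarith [hA 0 0, hA 0 1, hA 1 0, hA 1 1]

end EntrySum

section WordProd

variable {E : Type*}

/-- The product `A (x 0) * ⋯ * A (x (n - 1))` of the letters of the word `x`. -/
def wordProd {R : Type*} [Monoid R] (A : E → R) {n : ℕ} (x : Fin n → E) : R :=
  (List.ofFn fun i => A (x i)).prod

section Monoid

variable {R : Type*} [Monoid R] (A : E → R)

theorem wordProd_zero (x : Fin 0 → E) : wordProd A x = 1 := by
  rw [wordProd, List.ofFn_zero, List.prod_nil]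

theorem wordProd_succ {n : ℕ} (x : Fin (n + 1) → E) :
    wordProd A x = A (x 0) * wordProd A (Fin.tail x) := by
  rw [wordProd, List.ofFn_succ, List.prod_cons]
  rfl

theorem wordProd_add {m n : ℕ} (x : Fin (m + n) → E) :
    wordProd A x = wordProd A (fun i => x (i.castAdd n)) * wordProd A fun i => x (i.natAdd m) := by
  rw [wordProd, List.ofFn_add, List.prod_append]
  rfl

end Monoid

variable {ι : Type*} [Fintype ι] [DecidableEq ι] {A : E → Matrix ι ι ℝ}

theorem wordProd_apply_nonneg (hA : ∀ e i j, 0 ≤ A e i j) {n : ℕ} (x : Fin n → E) :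
    ∀ i j, 0 ≤ wordProd A x i j :=
  list_prod_apply_nonneg <| List.forall_mem_ofFn_iff.2 fun i => hA (x i)

theorem det_wordProd_eq_one (hA : ∀ e, (A e).det = 1) {n : ℕ} (x : Fin n → E) :
    (wordProd A x).det = 1 := by
  rw [wordProd, ← Matrix.coe_detMonoidHom, map_list_prod]
  exact List.prod_eq_one fun d hd => by
    obtain ⟨B, hB, rfl⟩ := List.mem_map.1 hd
    obtain ⟨i, rfl⟩ := List.mem_ofFn.1 hB
    exact hA (x i)

theorem wordProd_update_le {K : ℝ} (hA : ∀ e i j, 0 ≤ A e i j)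
    (hK : ∀ e e' i j, A e i j ≤ K * A e' i j) {n : ℕ} (x : Fin n → E) (k : Fin n) (e : E) :
    ∀ i j, wordProd A (Function.update x k e) i j ≤ K * wordProd A x i j := by
  induction n with
  | zero => exact k.elim0
  | succ n ih =>
    intro i j
    rw [wordProd_succ, wordProd_succ, Matrix.mul_apply, Matrix.mul_apply, Finset.mul_sum]
    refine Finset.sum_le_sum fun l _ => ?_
    cases k using Fin.cases with
    | zero =>
      rw [Fin.tail_update_zero, Function.update_self, ← mul_assoc]
      exact mul_le_mul_of_nonneg_right (hK _ _ i l) (wordProd_apply_nonneg hA _ l j)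
    | succ k =>
      rw [Fin.tail_update_succ, Function.update_of_ne (Fin.succ_ne_zero k).symm, mul_left_comm]
      exact mul_le_mul_of_nonneg_left (ih _ k l j) (hA _ i l)

variable [MeasurableSpace E]

theorem measurable_wordProd (hA : ∀ i j, Measurable fun e => A e i j) (n : ℕ) :
    ∀ i j, Measurable fun x : Fin n → E => wordProd A x i j := by
  induction n with
  | zero => exact fun i j => by simp only [wordProd_zero, measurable_const]
  | succ n ih =>
    intro i j
    simp only [wordProd_succ, Matrix.mul_apply]
    exact Finset.measurable_fun_sum _ fun k _ =>
      ((hA i k).comp (measurable_pi_apply 0)).mul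
        ((ih k j).comp (measurable_pi_lambda _ fun l => measurable_pi_apply l.succ))

theorem measurable_entrySum_wordProd (hA : ∀ i j, Measurable fun e => A e i j) (n : ℕ) :
    Measurable fun x : Fin n → E => entrySum (wordProd A x) :=
  Finset.measurable_fun_sum _ fun i _ => Finset.measurable_fun_sum _ fun j _ =>
    measurable_wordProd hA n i j

/-- The entrywise expectation of the random matrix `A e`. -/
noncomputable def meanMatrix (A : E → Matrix ι ι ℝ) (μ : Measure E) : Matrix ι ι ℝ :=
  Matrix.of fun i j => ∫ e, A e i j ∂μ

omit [Fintype ι] [DecidableEq ι] in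
theorem meanMatrix_nonneg (hA : ∀ e i j, 0 ≤ A e i j) (μ : Measure E) (i j : ι) :
    0 ≤ meanMatrix A μ i j :=
  integral_nonneg fun e => hA e i j

variable {μ : Measure E} [IsFiniteMeasure μ] (hA : ∀ i j, Integrable (fun e => A e i j) μ)
include hA

theorem integrable_wordProd (n : ℕ) :
    ∀ i j, Integrable (fun x : Fin n → E => wordProd A x i j) (Measure.pi fun _ => μ) := by
  induction n with
  | zero => exact fun i j => by simp only [wordProd_zero, integrable_const]
  | succ n ih =>
    intro i j
    simp only [wordProd_succ, Matrix.mul_apply]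
    exact integrable_finsetSum _ fun k _ =>
      (measurePreserving_finUncons (μ := fun _ => μ)).integrable_comp_of_integrable
        ((hA i k).mul_prod (ih k j))

theorem integral_wordProd (n : ℕ) :
    ∀ i j, ∫ x : Fin n → E, wordProd A x i j ∂(Measure.pi fun _ => μ)
      = (meanMatrix A μ ^ n) i j := by
  induction n with
  | zero => exact fun i j => by simp [wordProd_zero, measureReal_def]
  | succ n ih =>
    intro i j
    have hint (k : ι) := (hA i k).mul_prod (integrable_wordProd hA n k j)
    calc ∫ x : Fin (n + 1) → E, wordProd A x i j ∂(Measure.pi fun _ => μ)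
        = ∫ p, ∑ k, A p.1 i k * wordProd A p.2 k j ∂μ.prod (Measure.pi fun _ => μ) := by
          rw [← integral_pi_finUncons (n := n) (μ := fun _ => μ)]
          simp only [wordProd_succ, Matrix.mul_apply]
      _ = ∑ k, meanMatrix A μ i k * (meanMatrix A μ ^ n) k j := by
          rw [integral_finsetSum _ fun k _ => hint k]
          exact Finset.sum_congr rfl fun k _ => (integral_prod_mul (fun e => A e i k)
            fun x => wordProd A x k j).trans (congrArg (meanMatrix A μ i k * ·) (ih k j))
      _ = (meanMatrix A μ ^ (n + 1)) i j := by rw [pow_succ', Matrix.mul_apply]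

theorem integrable_entrySum_wordProd (n : ℕ) :
    Integrable (fun x : Fin n → E => entrySum (wordProd A x)) (Measure.pi fun _ => μ) :=
  integrable_finsetSum _ fun i _ => integrable_finsetSum _ fun j _ => integrable_wordProd hA n i j

theorem integral_entrySum_wordProd (n : ℕ) :
    ∫ x : Fin n → E, entrySum (wordProd A x) ∂(Measure.pi fun _ => μ)
      = entrySum (meanMatrix A μ ^ n) := by
  have hint (i : ι) : ∀ j ∈ Finset.univ, Integrable (fun x : Fin n → E => wordProd A x i j)
      (Measure.pi fun _ => μ) := fun j _ => integrable_wordProd hA n i j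
  simp only [entrySum]
  rw [integral_finsetSum _ fun i _ => integrable_finsetSum _ (hint i)]
  refine Finset.sum_congr rfl fun i _ => ?_
  rw [integral_finsetSum _ (hint i)]
  exact Finset.sum_congr rfl fun j _ => integral_wordProd hA n i j

end WordProd

section UniformlyComparable

/-- The logarithm of the Perron root of the product of a word, the quantity whose growth rate is
studied; for letters of determinant one it determines both eigenvalues of the product. -/
noncomputable def logPerron {E : Type*} (A : E → Matrix (Fin 2) (Fin 2) ℝ) {n : ℕ}
    (x : Fin n → E) : ℝ :=
  Real.log (eigMax (wordProd A x))

/-- A family of nonnegative `2 × 2` matrices of determinant one, any two rows of which, taken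
from the same or from different members, are entrywise comparable up to the factor `K`. -/
structure UniformlyComparable {E : Type*} (A : E → Matrix (Fin 2) (Fin 2) ℝ) (K : ℝ) : Prop where
  one_lt : 1 < K
  nonneg : ∀ e i j, 0 ≤ A e i j
  det_eq_one : ∀ e, (A e).det = 1
  le_mul : ∀ e e' i i' j, A e i j ≤ K * A e' i' j

namespace UniformlyComparable

variable {E : Type*} {A : E → Matrix (Fin 2) (Fin 2) ℝ} {K : ℝ} (h : UniformlyComparable A K)
  {n : ℕ}
include h

theorem pos : 0 < K :=
  zero_lt_one.trans h.one_lt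

theorem one_le_eigMax_wordProd (x : Fin n → E) : 1 ≤ eigMax (wordProd A x) :=
  one_le_eigMax (wordProd_apply_nonneg h.nonneg x) (det_wordProd_eq_one h.det_eq_one x)

theorem logPerron_nonneg (x : Fin n → E) : 0 ≤ logPerron A x :=
  Real.log_nonneg (h.one_le_eigMax_wordProd x)

theorem eigMax_wordProd_update_le (x : Fin n → E) (k : Fin n) (e : E) :
    eigMax (wordProd A (Function.update x k e)) ≤ K * eigMax (wordProd A x) := by
  rw [← eigMax_smul h.pos]
  exact eigMax_mono (wordProd_apply_nonneg h.nonneg _) fun i j =>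
    wordProd_update_le h.nonneg (fun e e' i j => h.le_mul e e' i i j) x k e i j

theorem logPerron_update_le (x : Fin n → E) (k : Fin n) (e : E) :
    logPerron A (Function.update x k e) ≤ Real.log K + logPerron A x := by
  have hpos (y : Fin n → E) : 0 < eigMax (wordProd A y) :=
    zero_lt_one.trans_le (h.one_le_eigMax_wordProd y)
  rw [logPerron, logPerron, ← Real.log_mul h.pos.ne' (hpos x).ne']
  exact Real.log_le_log (hpos _) (h.eigMax_wordProd_update_le x k e)

theorem hasBoundedDifferences_logPerron :
    HasBoundedDifferences (fun x : Fin n → E => logPerron A x)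
      fun _ => (Real.log K).toNNReal := by
  intro x k e
  have hback := h.logPerron_update_le (Function.update x k e) k (x k)
  rw [Function.update_idem, Function.update_eq_self] at hback
  rw [Real.coe_toNNReal _ (Real.log_nonneg h.one_lt.le), abs_le]
  constructor <;> linarith [h.logPerron_update_le x k e]

theorem logPerron_le_log_entrySum (x : Fin n → E) :
    logPerron A x ≤ Real.log (entrySum (wordProd A x)) :=
  Real.log_le_log (zero_lt_one.trans_le (h.one_le_eigMax_wordProd x))
    (eigMax_le_entrySum (wordProd_apply_nonneg h.nonneg x))

theorem one_le_entrySum_wordProd (x : Fin n → E) : 1 ≤ entrySum (wordProd A x) :=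
  (h.one_le_eigMax_wordProd x).trans (eigMax_le_entrySum (wordProd_apply_nonneg h.nonneg x))

theorem log_entrySum_le (x : Fin n → E) :
    Real.log (entrySum (wordProd A x)) ≤ Real.log (4 * K) + logPerron A x := by
  have heig : 0 < eigMax (wordProd A x) := zero_lt_one.trans_le (h.one_le_eigMax_wordProd x)
  have hsum : entrySum (wordProd A x) ≤ 2 * (K * (wordProd A x).trace) := by
    simpa only [Fintype.card_fin, Nat.cast_ofNat, wordProd] using
      entrySum_list_prod_le h.one_lt.le (List.forall_mem_ofFn_iff.2 fun i => h.nonneg (x i))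
        (List.forall_mem_ofFn_iff.2 fun i => h.le_mul (x i) (x i))
  have htrace : (wordProd A x).trace ≤ 2 * eigMax (wordProd A x) := by
    simpa only [pow_one] using
      trace_pow_le_two_mul_eigMax_pow (wordProd_apply_nonneg h.nonneg x) 1
  rw [logPerron, ← Real.log_mul (mul_pos four_pos h.pos).ne' heig.ne']
  refine Real.log_le_log (zero_lt_one.trans_le (h.one_le_entrySum_wordProd x)) ?_
  nlinarith [h.pos]

theorem log_entrySum_append_le {m : ℕ} (x : Fin (m + n) → E) :
    Real.log (entrySum (wordProd A x)) ≤
      Real.log (entrySum (wordProd A fun i => x (i.castAdd n)))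
        + Real.log (entrySum (wordProd A fun i => x (i.natAdd m))) := by
  have hpos {k : ℕ} (y : Fin k → E) : 0 < entrySum (wordProd A y) :=
    zero_lt_one.trans_le (h.one_le_entrySum_wordProd y)
  rw [← Real.log_mul (hpos _).ne' (hpos _).ne']
  refine Real.log_le_log (hpos x) ?_
  rw [wordProd_add]
  exact entrySum_mul_le (wordProd_apply_nonneg h.nonneg _) (wordProd_apply_nonneg h.nonneg _)

variable [MeasurableSpace E] (hA : ∀ i j, Measurable fun e => A e i j)
include hA

theorem measurable_logPerron : Measurable fun x : Fin n → E => logPerron A x := by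
  have hentry := measurable_wordProd hA n
  simp only [logPerron, eigMax_eq (four_mul_det_le_trace_sq (wordProd_apply_nonneg h.nonneg _)),
    Matrix.trace_fin_two, Matrix.det_fin_two]
  fun_prop

theorem integrable_logPerron (μ : Measure (Fin n → E)) [IsFiniteMeasure μ] :
    Integrable (fun x => logPerron A x) μ :=
  integrable_of_forall_abs_sub_le (h.measurable_logPerron hA).aestronglyMeasurable fun x y =>
    h.hasBoundedDifferences_logPerron.abs_sub_le_sum y x

theorem integrable_log_entrySum (μ : Measure (Fin n → E)) [IsFiniteMeasure μ] :
    Integrable (fun x => Real.log (entrySum (wordProd A x))) μ := by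
  refine ((integrable_const (Real.log (4 * K))).add (h.integrable_logPerron hA μ)).mono'
    (measurable_entrySum_wordProd hA n).log.aestronglyMeasurable (ae_of_all _ fun x => ?_)
  rw [Real.norm_of_nonneg (Real.log_nonneg (h.one_le_entrySum_wordProd x))]
  exact h.log_entrySum_le x

theorem integrable_apply (μ : Measure E) [IsFiniteMeasure μ] (i j : Fin 2) :
    Integrable (fun e => A e i j) μ := by
  obtain hE | ⟨⟨e₀⟩⟩ := isEmpty_or_nonempty E
  · exact .of_isEmpty
  · exact .of_mem_Icc 0 (K * A e₀ i j) (hA i j).aemeasurable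
      (ae_of_all _ fun e => ⟨h.nonneg e i j, h.le_mul e e₀ i i j⟩)

variable (μ : Measure E) [IsProbabilityMeasure μ]

theorem apply_le_mul_meanMatrix (e : E) (i i' j : Fin 2) :
    A e i j ≤ K * meanMatrix A μ i' j := by
  have hmono := integral_mono (integrable_const (A e i j))
    ((h.integrable_apply hA μ i' j).const_mul K) fun e' => h.le_mul e e' i i' j
  simpa only [integral_const, probReal_univ, one_smul, integral_const_mul, meanMatrix,
    Matrix.of_apply] using hmono

theorem rowsComparable_meanMatrix : RowsComparable K (meanMatrix A μ) := by
  intro i i' j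
  have hmono := integral_mono (h.integrable_apply hA μ i j)
    (integrable_const (K * meanMatrix A μ i' j)) fun e =>
      h.apply_le_mul_meanMatrix hA μ e i i' j
  simpa only [integral_const, probReal_univ, one_smul, meanMatrix, Matrix.of_apply] using hmono

theorem eigMax_meanMatrix_pos : 0 < eigMax (meanMatrix A μ) := by
  obtain ⟨e⟩ : Nonempty E := nonempty_of_isProbabilityMeasure μ
  have hle : eigMax (A e) ≤ K * eigMax (meanMatrix A μ) := by
    rw [← eigMax_smul h.pos]
    exact eigMax_mono (h.nonneg e) fun i j => h.apply_le_mul_meanMatrix hA μ e i i j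
  have hone := one_le_eigMax (h.nonneg e) (h.det_eq_one e)
  exact pos_of_mul_pos_right (zero_lt_one.trans_le (hone.trans hle)) h.pos.le

theorem entrySum_meanMatrix_pow_le :
    entrySum (meanMatrix A μ ^ n) ≤ 4 * K * eigMax (meanMatrix A μ) ^ n := by
  have hsum : entrySum (meanMatrix A μ ^ n) ≤ 2 * (K * (meanMatrix A μ ^ n).trace) := by
    simpa only [Fintype.card_fin, Nat.cast_ofNat, List.prod_replicate] using
      entrySum_list_prod_le (l := List.replicate n (meanMatrix A μ)) h.one_lt.le
        (fun B hB => List.eq_of_mem_replicate hB ▸ meanMatrix_nonneg h.nonneg μ)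
        (fun B hB => List.eq_of_mem_replicate hB ▸ h.rowsComparable_meanMatrix hA μ)
  nlinarith [h.pos, trace_pow_le_two_mul_eigMax_pow (meanMatrix_nonneg h.nonneg μ) n]

-- Jensen's inequality, together with `E (A₁ ⋯ Aₙ) = (E A)ⁿ` for independent factors.
theorem integral_log_entrySum_le :
    ∫ x : Fin n → E, Real.log (entrySum (wordProd A x)) ∂(Measure.pi fun _ => μ)
      ≤ Real.log (4 * K) + n * Real.log (eigMax (meanMatrix A μ)) := by
  have hpos : 0 < eigMax (meanMatrix A μ) := h.eigMax_meanMatrix_pos hA μ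
  have hconcave : ConcaveOn ℝ (Set.Ici 1) Real.log :=
    strictConcaveOn_log_Ioi.concaveOn.subset (Set.Ici_subset_Ioi.2 one_pos) (convex_Ici 1)
  have hcont : ContinuousOn Real.log (Set.Ici 1) :=
    Real.continuousOn_log.mono fun y hy => (zero_lt_one.trans_le hy).ne'
  have hint := integrable_entrySum_wordProd (h.integrable_apply hA μ) n
  have hmean := integral_entrySum_wordProd (h.integrable_apply hA μ) n
  have hone : 1 ≤ entrySum (meanMatrix A μ ^ n) := by
    simpa only [hmean, integral_const, probReal_univ, one_smul] using
      integral_mono (integrable_const 1) hint fun x => h.one_le_entrySum_wordProd x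
  calc ∫ x : Fin n → E, Real.log (entrySum (wordProd A x)) ∂(Measure.pi fun _ => μ)
      ≤ Real.log (entrySum (meanMatrix A μ ^ n)) := by
        rw [← hmean]
        exact hconcave.le_map_integral hcont isClosed_Ici
          (ae_of_all _ h.one_le_entrySum_wordProd) hint (h.integrable_log_entrySum hA _)
    _ ≤ Real.log (4 * K * eigMax (meanMatrix A μ) ^ n) :=
        Real.log_le_log (zero_lt_one.trans_le hone) (h.entrySum_meanMatrix_pow_le hA μ)
    _ = Real.log (4 * K) + n * Real.log (eigMax (meanMatrix A μ)) := by
        rw [Real.log_mul (mul_pos four_pos h.pos).ne' (by positivity), Real.log_pow]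

end UniformlyComparable

end UniformlyComparable

section Convergence

theorem exists_tendsto_div_of_subadditive {u p : ℕ → ℝ} (hu : Subadditive u) {c d r : ℝ}
    (hp : ∀ n, 0 ≤ p n) (hpu : ∀ n, p n ≤ u n) (hup : ∀ n, u n ≤ c + p n)
    (hur : ∀ n, u n ≤ d + n * r) :
    ∃ l, Tendsto (fun n : ℕ => p n / n) atTop (𝓝 l) ∧ l ≤ r := by
  have hdiv {a b : ℕ → ℝ} (hab : ∀ n, a n ≤ b n) (n : ℕ) : a n / n ≤ b n / n :=
    div_le_div_of_nonneg_right (hab n) n.cast_nonneg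
  have hconst (a : ℝ) : Tendsto (fun n : ℕ => a / n) atTop (𝓝 0) :=
    tendsto_const_div_atTop_nhds_zero_nat a
  have hbdd : BddBelow (Set.range fun n : ℕ => u n / n) :=
    ⟨0, Set.forall_mem_range.2 fun n => div_nonneg ((hp n).trans (hpu n)) n.cast_nonneg⟩
  have hlim := hu.tendsto_lim hbdd
  refine ⟨hu.lim, ?_, ?_⟩
  · refine tendsto_of_tendsto_of_tendsto_of_le_of_le
      (by simpa only [sub_zero, ← sub_div] using hlim.sub (hconst c)) hlim
      (hdiv fun n => ?_) (hdiv hpu)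
    linarith [hup n]
  · have hbound : Tendsto (fun n : ℕ => d / n + r) atTop (𝓝 r) := by
      simpa only [zero_add] using (hconst d).add_const r
    refine le_of_tendsto_of_tendsto hlim hbound ?_
    filter_upwards [eventually_ne_atTop 0] with n hn
    have hn' : (n : ℝ) ≠ 0 := Nat.cast_ne_zero.2 hn
    calc u n / n ≤ (d + n * r) / n := hdiv hur n
      _ = d / n + r := by rw [add_div, mul_div_cancel_left₀ _ hn']

variable {Ω : Type*} [MeasurableSpace Ω] {P : Measure Ω}

theorem ae_tendsto_zero_of_summable_measureReal [IsFiniteMeasure P] {Z : ℕ → Ω → ℝ}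
    (h : ∀ ε : ℝ, 0 < ε → Summable fun n => P.real {ω | ε ≤ |Z n ω|}) :
    ∀ᵐ ω ∂P, Tendsto (fun n => Z n ω) atTop (𝓝 0) := by
  have eventually_small (k : ℕ) : ∀ᵐ ω ∂P, ∀ᶠ n in atTop, |Z n ω| < 1 / ((k : ℝ) + 1) := by
    have hsum : ∑' n, P {ω | 1 / ((k : ℝ) + 1) ≤ |Z n ω|} ≠ ⊤ := by
      rw [tsum_congr fun n => (ofReal_measureReal (μ := P)).symm]
      exact (h (1 / ((k : ℝ) + 1)) Nat.one_div_pos_of_nat).tsum_ofReal_ne_top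
    filter_upwards [ae_eventually_notMem hsum] with ω hω
    simpa only [Set.mem_ofPred_eq, not_le] using hω
  filter_upwards [ae_all_iff.2 eventually_small] with ω hω
  refine Metric.tendsto_nhds.2 fun δ hδ => ?_
  obtain ⟨k, hk⟩ := exists_nat_one_div_lt hδ
  filter_upwards [hω k] with n hn
  rw [Real.dist_0_eq_abs]
  exact hn.trans hk

variable {σ : ℝ≥0}

theorem measureReal_ge_le_of_hasSubgaussianMGF_div {Z : Ω → ℝ} {n : ℕ}
    (h : HasSubgaussianMGF Z (σ / n) P) {ε : ℝ} (hε : 0 ≤ ε) :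
    P.real {ω | ε ≤ Z ω} ≤ Real.exp (-(1 / (2 * σ)) * ε ^ 2 * n) := by
  convert h.measure_ge_le hε using 2
  push_cast
  rw [mul_div_assoc', div_div_eq_mul_div]
  ring

theorem measureReal_le_neg_le_of_hasSubgaussianMGF_div {Z : Ω → ℝ} {n : ℕ}
    (h : HasSubgaussianMGF Z (σ / n) P) {ε : ℝ} (hε : 0 ≤ ε) :
    P.real {ω | Z ω ≤ -ε} ≤ Real.exp (-(1 / (2 * σ)) * ε ^ 2 * n) := by
  simpa only [Pi.neg_apply, le_neg] using measureReal_ge_le_of_hasSubgaussianMGF_div h.neg hε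

theorem ae_tendsto_zero_of_hasSubgaussianMGF_div [IsFiniteMeasure P] (hσ : 0 < σ)
    {Z : ℕ → Ω → ℝ} (h : ∀ n : ℕ, HasSubgaussianMGF (Z n) (σ / n) P) :
    ∀ᵐ ω ∂P, Tendsto (fun n => Z n ω) atTop (𝓝 0) := by
  refine ae_tendsto_zero_of_summable_measureReal fun ε hε => ?_
  have hrate : -(1 / (2 * σ)) * ε ^ 2 < 0 := by
    rw [neg_mul, neg_lt_zero]
    positivity
  have htail (n : ℕ) : P.real {ω | ε ≤ |Z n ω|} ≤
      2 * Real.exp (n * (-(1 / (2 * σ)) * ε ^ 2)) := by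
    have hsub : {ω | ε ≤ |Z n ω|} ⊆ {ω | ε ≤ Z n ω} ∪ {ω | Z n ω ≤ -ε} :=
      fun ω (hω : ε ≤ |Z n ω|) => (le_abs.1 hω).imp id le_neg_of_le_neg
    rw [mul_comm (n : ℝ)]
    linarith [(measureReal_mono hsub).trans (measureReal_union_le (μ := P) _ _),
      measureReal_ge_le_of_hasSubgaussianMGF_div (h n) hε.le,
      measureReal_le_neg_le_of_hasSubgaussianMGF_div (h n) hε.le]
  exact .of_nonneg_of_le (fun _ => measureReal_nonneg) htail
    ((Real.summable_exp_nat_mul_iff.2 hrate).mul_left 2)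

end Convergence

section RandomWords

variable {Ω E : Type*} [MeasurableSpace Ω] [MeasurableSpace E] {P : Measure Ω}
  {ξ : ℕ → Ω → E} (hindep : iIndepFun ξ P) (hident : ∀ i, IdentDistrib (ξ i) (ξ 0) P P)
include hindep hident

theorem hasLaw_block (k n : ℕ) :
    HasLaw (fun ω (i : Fin n) => ξ (k + i) ω) (Measure.pi fun _ => P.map (ξ 0)) P :=
  (hindep.precomp (g := fun i : Fin n => k + (i : ℕ)) fun _ _ hij =>
    Fin.ext (Nat.add_left_cancel hij)).hasLaw_pi fun _ =>
      ⟨(hident _).aemeasurable_fst, (hident _).map_eq⟩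

theorem hasLaw_initial_block (n : ℕ) :
    HasLaw (fun ω (i : Fin n) => ξ i ω) (Measure.pi fun _ => P.map (ξ 0)) P := by
  simpa only [zero_add] using hasLaw_block hindep hident 0 n

omit hindep hident in
theorem integrable_comp_of_hasLaw {X : Ω → E} {μ : Measure E} (hX : HasLaw X μ P) {f : E → ℝ}
    (hf : Integrable f μ) : Integrable (fun ω => f (X ω)) P := by
  rw [← hX.map_eq] at hf
  exact hf.comp_aemeasurable hX.aemeasurable

variable [IsProbabilityMeasure P] {A : E → Matrix (Fin 2) (Fin 2) ℝ} {K : ℝ}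
  (h : UniformlyComparable A K) (hA : ∀ i j, Measurable fun e => A e i j)
include h hA

theorem subadditive_integral_log_entrySum :
    Subadditive fun n => ∫ ω, Real.log (entrySum (wordProd A fun i : Fin n => ξ i ω)) ∂P := by
  intro m n
  have : IsProbabilityMeasure (P.map (ξ 0)) :=
    Measure.isProbabilityMeasure_map (hident 0).aemeasurable_fst
  have hint (k n : ℕ) :
      Integrable (fun ω => Real.log (entrySum (wordProd A fun i : Fin n => ξ (k + i) ω))) P :=
    integrable_comp_of_hasLaw (hasLaw_block hindep hident k n) (h.integrable_log_entrySum hA _)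
  have hstat (k : ℕ) :
      ∫ ω, Real.log (entrySum (wordProd A fun i : Fin n => ξ (k + i) ω)) ∂P
        = ∫ x : Fin n → E, Real.log (entrySum (wordProd A x)) ∂Measure.pi fun _ => P.map (ξ 0) :=
    (hasLaw_block hindep hident k n).integral_comp
      (h.integrable_log_entrySum hA _).aestronglyMeasurable
  have hshift := (hstat m).trans (hstat 0).symm
  simp only [zero_add] at hshift
  have hint₀ (n : ℕ) := hint 0 n
  simp only [zero_add] at hint₀
  dsimp only
  rw [← hshift, ← integral_add (hint₀ m) (hint m n)]
  exact integral_mono (hint₀ _) ((hint₀ m).add (hint m n)) fun ω =>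
    h.log_entrySum_append_le fun i => ξ i ω

theorem integrable_logPerron_block (n : ℕ) :
    Integrable (fun ω => logPerron A fun i : Fin n => ξ i ω) P :=
  have : IsProbabilityMeasure (P.map (ξ 0)) :=
    Measure.isProbabilityMeasure_map (hident 0).aemeasurable_fst
  integrable_comp_of_hasLaw (hasLaw_initial_block hindep hident n) (h.integrable_logPerron hA _)

theorem exists_tendsto_integral_logPerron_div :
    ∃ l, Tendsto (fun n : ℕ => (∫ ω, logPerron A (fun i : Fin n => ξ i ω) ∂P) / n) atTop (𝓝 l) ∧
      l ≤ Real.log (eigMax (meanMatrix A (P.map (ξ 0)))) := by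
  have : IsProbabilityMeasure (P.map (ξ 0)) :=
    Measure.isProbabilityMeasure_map (hident 0).aemeasurable_fst
  have hlogPerron := integrable_logPerron_block hindep hident h hA
  have hlaw := hasLaw_initial_block hindep hident
  have hentrySum (n : ℕ) :=
    integrable_comp_of_hasLaw (hlaw n) (h.integrable_log_entrySum hA (n := n) _)
  refine exists_tendsto_div_of_subadditive (subadditive_integral_log_entrySum hindep hident h hA)
    (c := Real.log (4 * K)) (d := Real.log (4 * K)) (fun n => ?_) (fun n => ?_) (fun n => ?_)
    fun n => ?_
  · exact integral_nonneg fun ω => h.logPerron_nonneg _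
  · exact integral_mono (hlogPerron n) (hentrySum n) fun ω => h.logPerron_le_log_entrySum _
  · have hmono := integral_mono (hentrySum n) ((integrable_const _).add (hlogPerron n))
      fun ω => h.log_entrySum_le _
    simpa only [Pi.add_apply, integral_add (integrable_const _) (hlogPerron n), integral_const,
      probReal_univ, one_smul] using hmono
  · exact ((hlaw n).integral_comp
      (h.integrable_log_entrySum hA _).aestronglyMeasurable).trans_le
        (h.integral_log_entrySum_le hA _)

theorem hasSubgaussianMGF_logPerron (n : ℕ) :
    HasSubgaussianMGF (fun ω => logPerron A (fun i : Fin n => ξ i ω)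
      - ∫ ω', logPerron A (fun i : Fin n => ξ i ω') ∂P)
      (n * (Real.log K).toNNReal ^ 2 / 4) P := by
  have : IsProbabilityMeasure (P.map (ξ 0)) :=
    Measure.isProbabilityMeasure_map (hident 0).aemeasurable_fst
  have hlaw := hasLaw_initial_block hindep hident n
  have hmean := hlaw.integral_comp (h.measurable_logPerron hA).aestronglyMeasurable
  have hsub := h.hasBoundedDifferences_logPerron.hasSubgaussianMGF
    (μ := fun _ : Fin n => P.map (ξ 0)) (h.measurable_logPerron hA)
  rw [← hmean, Finset.sum_const, Finset.card_univ, Fintype.card_fin, nsmul_eq_mul] at hsub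
  exact .of_map hlaw.aemeasurable (hlaw.map_eq.symm ▸ hsub)

end RandomWords

section TransferProduct

/-- The matrix of determinant one proportional to the transfer matrix `M x`, as a function of
`y = (1 + x)⁻¹`; in this parametrization it is affine. -/
def unimodularM (y : ℝ) : Matrix (Fin 2) (Fin 2) ℝ :=
  !![1, 1; y, 1 + y]

theorem M_eq_smul_unimodularM {x : ℝ} (hx : 1 + x ≠ 0) :
    M x = (1 + x) • unimodularM (1 + x)⁻¹ := by
  ext i j
  fin_cases i <;> fin_cases j <;>
    simp only [M, unimodularM, Matrix.smul_of, Matrix.of_apply, Matrix.smul_cons, Matrix.smul_empty,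
      Matrix.cons_val, smul_eq_mul, mul_add, mul_one, mul_inv_cancel₀ hx, Fin.zero_eta, Fin.mk_one,
      Fin.isValue]
  ring

theorem det_unimodularM (y : ℝ) : (unimodularM y).det = 1 := by
  simp [unimodularM, Matrix.det_fin_two]

theorem unimodularM_nonneg {y : ℝ} (hy : 0 ≤ y) (i j : Fin 2) : 0 ≤ unimodularM y i j := by
  fin_cases i <;> fin_cases j <;>
    simp only [unimodularM, Matrix.of_apply, Matrix.cons_val, Fin.zero_eta, Fin.mk_one,
      Fin.isValue] <;> linarith

theorem unimodularM_apply_mem_Icc {α β y : ℝ} (hα : 0 < α) (hy : y ∈ Set.Icc α β) (i j : Fin 2) :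
    unimodularM y i j ∈ Set.Icc (1 + α⁻¹)⁻¹ (1 + β) := by
  have hαinv : 0 < α⁻¹ := inv_pos.2 hα
  have hone : (1 + α⁻¹)⁻¹ ≤ 1 := inv_le_one_of_one_le₀ (by linarith)
  have hle : (1 + α⁻¹)⁻¹ ≤ α := inv_le_of_inv_le₀ hα (by linarith)
  obtain ⟨hαy, hyβ⟩ := hy
  fin_cases i <;> fin_cases j <;>
    simp only [unimodularM, Matrix.of_apply, Matrix.cons_val, Fin.zero_eta, Fin.mk_one,
      Fin.isValue] <;> constructor <;> linarith

theorem log_LambdaPlus_div_LambdaMinus {γ : ℝ} (hγ : 0 < γ) :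
    Real.log (LambdaPlus γ / LambdaMinus γ) = 2 * Real.log (eigMax (unimodularM γ⁻¹)) := by
  have htrace : (M (γ - 1)).trace = 2 * γ + 1 := by
    rw [M, Matrix.trace_fin_two_of]
    ring
  have hdisc : (M (γ - 1)).trace ^ 2 - 4 * (M (γ - 1)).det = 4 * γ + 1 := by
    rw [M, Matrix.trace_fin_two_of, Matrix.det_fin_two_of]
    ring
  have hreal : 4 * (M (γ - 1)).det ≤ (M (γ - 1)).trace ^ 2 := by linarith
  have hplus : eigMax (M (γ - 1)) = LambdaPlus γ := by
    rw [eigMax_eq hreal, hdisc, htrace, LambdaPlus]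
  have hminus : eigMin (M (γ - 1)) = LambdaMinus γ := by
    rw [eigMin_eq hreal, hdisc, htrace, LambdaMinus]
  rw [← hplus, ← hminus, M_eq_smul_unimodularM (by linarith), add_sub_cancel]
  exact log_eigMax_div_eigMin_smul (unimodularM_nonneg (inv_nonneg.2 hγ.le))
    (det_unimodularM _) hγ

/-- The unimodular transfer matrix at `x`, with `x` first clamped to `[a, b]`. Clamping makes the
matrices uniformly comparable on all of `ℝ`, hence for every and not only almost every sample. -/
noncomputable def clampedM (a b x : ℝ) : Matrix (Fin 2) (Fin 2) ℝ :=
  unimodularM (1 + max a (min b x))⁻¹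

theorem clampedM_of_mem {a b x : ℝ} (hx : x ∈ Set.Icc a b) :
    clampedM a b x = unimodularM (1 + x)⁻¹ := by
  rw [clampedM, min_eq_right hx.2, max_eq_right hx.1]

theorem measurable_clampedM (a b : ℝ) (i j : Fin 2) : Measurable fun x => clampedM a b x i j := by
  fin_cases i <;> fin_cases j <;>
    simp only [clampedM, unimodularM, Matrix.of_apply, Matrix.cons_val, Fin.zero_eta, Fin.mk_one,
      Fin.isValue] <;> fun_prop

variable {a b : ℝ} (ha : -1 < a)
include ha

theorem inv_one_add_mem_Icc {x : ℝ} (hx : x ∈ Set.Icc a b) :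
    (1 + x)⁻¹ ∈ Set.Icc (1 + b)⁻¹ (1 + a)⁻¹ :=
  ⟨inv_anti₀ (by linarith [hx.1]) (by linarith [hx.2]),
    inv_anti₀ (by linarith) (by linarith [hx.1])⟩

theorem uniformlyComparable_clampedM (hab : a ≤ b) :
    UniformlyComparable (clampedM a b) ((1 + (1 + a)⁻¹) * (2 + b)) := by
  have ha₀ : 0 < (1 + a)⁻¹ := inv_pos.2 (by linarith)
  have hb₀ : 0 < 2 + b := by linarith
  have hclamp (x : ℝ) : max a (min b x) ∈ Set.Icc a b :=
    ⟨le_max_left _ _, max_le hab (min_le_left _ _)⟩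
  have hentry (x : ℝ) (i j : Fin 2) :
      clampedM a b x i j ∈ Set.Icc (2 + b)⁻¹ (1 + (1 + a)⁻¹) := by
    have hmem := unimodularM_apply_mem_Icc (inv_pos.2 (by linarith))
      (inv_one_add_mem_Icc ha (hclamp x)) i j
    rwa [inv_inv, ← add_assoc, one_add_one_eq_two] at hmem
  refine ⟨?_, fun x i j => (inv_nonneg.2 hb₀.le).trans (hentry x i j).1,
    fun x => det_unimodularM _, fun x x' i i' j => ?_⟩
  · nlinarith
  · calc clampedM a b x i j ≤ (1 + (1 + a)⁻¹) * ((2 + b) * (2 + b)⁻¹) := by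
          rw [mul_inv_cancel₀ hb₀.ne', mul_one]
          exact (hentry x i j).2
      _ ≤ (1 + (1 + a)⁻¹) * ((2 + b) * clampedM a b x' i' j) := by
          gcongr
          exact (hentry x' i' j).1
      _ = (1 + (1 + a)⁻¹) * (2 + b) * clampedM a b x' i' j := (mul_assoc _ _ _).symm

theorem meanMatrix_clampedM {μ : Measure ℝ} [IsProbabilityMeasure μ]
    (hμ : ∀ᵐ x ∂μ, x ∈ Set.Icc a b) :
    meanMatrix (clampedM a b) μ = unimodularM (∫ x, (1 + x)⁻¹ ∂μ) := by
  have hint : Integrable (fun x : ℝ => (1 + x)⁻¹) μ :=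
    .of_mem_Icc (1 + b)⁻¹ (1 + a)⁻¹ (by fun_prop) (hμ.mono fun x hx => inv_one_add_mem_Icc ha hx)
  have hcongr (i j : Fin 2) :
      meanMatrix (clampedM a b) μ i j = ∫ x, unimodularM (1 + x)⁻¹ i j ∂μ :=
    integral_congr_ae (hμ.mono fun x hx => by simp only [clampedM_of_mem hx])
  ext i j
  rw [hcongr]
  fin_cases i <;> fin_cases j <;>
    simp [unimodularM, integral_add (integrable_const _) hint]

variable {x : ℕ → ℝ} (hx : ∀ i, x i ∈ Set.Icc a b) (n : ℕ)
include hx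

theorem prod_one_add_pos : 0 < ∏ i ∈ Finset.range n, (1 + x i) :=
  Finset.prod_pos fun i _ => by linarith [(hx i).1]

theorem prodM_eq_smul_wordProd :
    prodM x n = (∏ i ∈ Finset.range n, (1 + x i)) •
      wordProd (clampedM a b) fun i : Fin n => x i := by
  have hword (n : ℕ) : wordProd (clampedM a b) (fun i : Fin n => x i)
      = ((List.range n).map fun i => clampedM a b (x i)).prod := by
    rw [wordProd, List.ofFn_eq_map, ← List.map_coe_finRange_eq_range, List.map_map]
    rfl
  induction n with
  | zero => simp [prodM, hword]
  | succ n ih =>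
    rw [hword] at ih ⊢
    have hM : M (x n) = (1 + x n) • clampedM a b (x n) := by
      rw [clampedM_of_mem (hx n), M_eq_smul_unimodularM (by linarith [(hx n).1])]
    rw [prodM, List.range_succ, List.map_append, List.map_append, List.prod_append,
      List.prod_append, List.map_singleton, List.map_singleton, List.prod_singleton,
      List.prod_singleton, Finset.prod_range_succ, ← prodM, ih, hM, smul_mul_smul_comm]

theorem log_prod_one_add :
    Real.log (∏ i ∈ Finset.range n, (1 + x i)) = ∑ i ∈ Finset.range n, Real.log (1 + x i) :=
  Real.log_prod fun i _ => by linarith [(hx i).1]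

theorem prodM_nonneg (i j : Fin 2) : 0 ≤ prodM x n i j := by
  rw [prodM_eq_smul_wordProd ha hx]
  exact mul_nonneg (prod_one_add_pos ha hx n).le (wordProd_apply_nonneg
    (uniformlyComparable_clampedM ha ((hx 0).1.trans (hx 0).2)).nonneg _ i j)

theorem eigMin_prodM_pos : 0 < eigMin (prodM x n) := by
  have hdet : (prodM x n).det = (∏ i ∈ Finset.range n, (1 + x i)) ^ 2 := by
    rw [prodM_eq_smul_wordProd ha hx, Matrix.det_smul, Fintype.card_fin,
      det_wordProd_eq_one (A := clampedM a b) fun _ => det_unimodularM _, mul_one]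
  exact eigMin_pos (prodM_nonneg ha hx n) (hdet ▸ pow_pos (prod_one_add_pos ha hx n) 2)

theorem log_eigMax_prodM :
    Real.log (eigMax (prodM x n)) = ∑ i ∈ Finset.range n, Real.log (1 + x i)
      + logPerron (clampedM a b) fun i : Fin n => x i := by
  have h := uniformlyComparable_clampedM ha ((hx 0).1.trans (hx 0).2)
  rw [prodM_eq_smul_wordProd ha hx, log_eigMax_smul (wordProd_apply_nonneg h.nonneg _)
    (det_wordProd_eq_one h.det_eq_one _) (prod_one_add_pos ha hx n), log_prod_one_add ha hx,
    logPerron]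

theorem log_eigMin_prodM :
    Real.log (eigMin (prodM x n)) = ∑ i ∈ Finset.range n, Real.log (1 + x i)
      - logPerron (clampedM a b) fun i : Fin n => x i := by
  have h := uniformlyComparable_clampedM ha ((hx 0).1.trans (hx 0).2)
  rw [prodM_eq_smul_wordProd ha hx, log_eigMin_smul (wordProd_apply_nonneg h.nonneg _)
    (det_wordProd_eq_one h.det_eq_one _) (prod_one_add_pos ha hx n), log_prod_one_add ha hx,
    logPerron]

theorem Y_eq_two_div_mul_logPerron :
    Y x n = 2 / n * logPerron (clampedM a b) fun i : Fin n => x i := by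
  have h := uniformlyComparable_clampedM ha ((hx 0).1.trans (hx 0).2)
  rw [Y, prodM_eq_smul_wordProd ha hx, log_eigMax_div_eigMin_smul
    (wordProd_apply_nonneg h.nonneg _) (det_wordProd_eq_one h.det_eq_one _)
    (prod_one_add_pos ha hx n), ← logPerron]
  ring

end TransferProduct

section RandomTransferProduct

variable {Ω : Type*} [MeasurableSpace Ω] {P : Measure Ω} [IsProbabilityMeasure P] {a b : ℝ}

omit [IsProbabilityMeasure P] in
theorem ae_forall_mem_of_identDistrib {E : Type*} [MeasurableSpace E] {X : ℕ → Ω → E} {s : Set E}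
    (hs : MeasurableSet s) (hident : ∀ i, IdentDistrib (X i) (X 0) P P)
    (hsupp : ∀ᵐ ω ∂P, X 0 ω ∈ s) : ∀ᵐ ω ∂P, ∀ i, X i ω ∈ s :=
  ae_all_iff.2 fun i => (hident i).symm.ae_mem_snd hs hsupp

section SingleVariable

variable {X : Ω → ℝ} (hX : AEMeasurable X P) (ha : -1 < a) (hsupp : ∀ᵐ ω ∂P, X ω ∈ Set.Icc a b)
include hX ha hsupp

theorem integrable_log_one_add : Integrable (fun ω => Real.log (1 + X ω)) P := by
  refine .of_mem_Icc (Real.log (1 + a)) (Real.log (1 + b)) (by fun_prop) ?_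
  filter_upwards [hsupp] with ω hω
  exact ⟨Real.log_le_log (by linarith) (by linarith [hω.1]),
    Real.log_le_log (by linarith [hω.1]) (by linarith [hω.2])⟩

theorem integrable_inv_one_add : Integrable (fun ω => (1 + X ω)⁻¹) P :=
  .of_mem_Icc (1 + b)⁻¹ (1 + a)⁻¹ (by fun_prop)
    (hsupp.mono fun _ hω => inv_one_add_mem_Icc ha hω)

theorem inv_integral_inv_one_add_mem_Icc :
    (∫ ω, (1 + X ω)⁻¹ ∂P)⁻¹ ∈ Set.Icc (1 + a) (1 + b) := by
  obtain ⟨ω, hω⟩ := hsupp.exists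
  have hint := integrable_inv_one_add hX ha hsupp
  have hlower : (1 + b)⁻¹ ≤ ∫ ω, (1 + X ω)⁻¹ ∂P := by
    simpa only [integral_const, probReal_univ, one_smul] using
      integral_mono_ae (integrable_const _) hint
        (hsupp.mono fun ω hω => (inv_one_add_mem_Icc ha hω).1)
  have hupper : ∫ ω, (1 + X ω)⁻¹ ∂P ≤ (1 + a)⁻¹ := by
    simpa only [integral_const, probReal_univ, one_smul] using
      integral_mono_ae hint (integrable_const _)
        (hsupp.mono fun ω hω => (inv_one_add_mem_Icc ha hω).2)
  have hb : 0 < 1 + b := by linarith [hω.1, hω.2]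
  have hpos : 0 < ∫ ω, (1 + X ω)⁻¹ ∂P := (inv_pos.2 hb).trans_le hlower
  exact ⟨(le_inv_comm₀ (by linarith) hpos).2 hupper, (inv_le_comm₀ hb hpos).1 hlower⟩

end SingleVariable

variable {X : ℕ → Ω → ℝ} (hindep : iIndepFun X P) (hident : ∀ i, IdentDistrib (X i) (X 0) P P)
  (ha : -1 < a) (hsupp : ∀ᵐ ω ∂P, X 0 ω ∈ Set.Icc a b)
include hindep hident ha hsupp

omit hindep [IsProbabilityMeasure P] in
theorem Y_ae_eq (n : ℕ) :
    (fun ω => Y (fun i => X i ω) n)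
      =ᵐ[P] fun ω => 2 / n * logPerron (clampedM a b) fun i : Fin n => X i ω := by
  filter_upwards [ae_forall_mem_of_identDistrib measurableSet_Icc hident hsupp] with ω hω
  exact Y_eq_two_div_mul_logPerron ha hω n

omit hindep [IsProbabilityMeasure P] in
theorem integral_Y (n : ℕ) :
    ∫ ω, Y (fun i => X i ω) n ∂P
      = 2 / n * ∫ ω, logPerron (clampedM a b) (fun i : Fin n => X i ω) ∂P := by
  rw [integral_congr_ae (Y_ae_eq hident ha hsupp n), integral_const_mul]

omit hindep hident in
theorem uniformlyComparable_clampedM_of_ae_mem :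
    UniformlyComparable (clampedM a b) ((1 + (1 + a)⁻¹) * (2 + b)) :=
  have ⟨_, hω⟩ := hsupp.exists
  uniformlyComparable_clampedM ha (hω.1.trans hω.2)

theorem integrable_Y (n : ℕ) : Integrable (fun ω => Y (fun i => X i ω) n) P :=
  ((integrable_logPerron_block hindep hident (uniformlyComparable_clampedM_of_ae_mem ha hsupp)
    (measurable_clampedM a b) n).const_mul _).congr (Y_ae_eq hident ha hsupp n).symm

theorem exists_hasSubgaussianMGF_Y :
    ∃ σ : ℝ≥0, 0 < σ ∧ ∀ n : ℕ, HasSubgaussianMGF (fun ω => Y (fun i => X i ω) n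
      - ∫ ω', Y (fun i => X i ω') n ∂P) (σ / n) P := by
  have h := uniformlyComparable_clampedM_of_ae_mem ha hsupp
  set L : ℝ≥0 := (Real.log ((1 + (1 + a)⁻¹) * (2 + b))).toNNReal
  refine ⟨L ^ 2, pow_pos (Real.toNNReal_pos.2 (Real.log_pos h.one_lt)) 2, fun n => ?_⟩
  have hsub := (hasSubgaussianMGF_logPerron hindep hident h
    (measurable_clampedM a b) n).const_mul (2 / n)
  have hparam : ((L ^ 2 / n : ℝ≥0) : ℝ) = (2 / n) ^ 2 * (n * L ^ 2 / 4 : ℝ≥0) := by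
    push_cast
    obtain rfl | hn := eq_or_ne n 0
    · simp
    · field_simp
      ring
  convert hsub.congr ?_ using 1
  · exact NNReal.eq hparam
  · filter_upwards [Y_ae_eq hident ha hsupp n] with ω hω
    rw [hω, integral_Y hident ha hsupp, mul_sub]

theorem exists_tendsto_integral_Y :
    ∃ l, Tendsto (fun n : ℕ => ∫ ω, Y (fun i => X i ω) n ∂P) atTop (𝓝 l) ∧
      l ≤ Real.log (LambdaPlus (∫ ω, (1 + X 0 ω)⁻¹ ∂P)⁻¹
        / LambdaMinus (∫ ω, (1 + X 0 ω)⁻¹ ∂P)⁻¹) := by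
  have hX := (hident 0).aemeasurable_fst
  have : IsProbabilityMeasure (P.map (X 0)) := Measure.isProbabilityMeasure_map hX
  have hmean : meanMatrix (clampedM a b) (P.map (X 0))
      = unimodularM (∫ ω, (1 + X 0 ω)⁻¹ ∂P) := by
    rw [meanMatrix_clampedM ha ((ae_map_iff hX measurableSet_Icc).2 hsupp),
      integral_map hX (by fun_prop)]
  have hγ : 0 < (∫ ω, (1 + X 0 ω)⁻¹ ∂P)⁻¹ := by
    linarith [(inv_integral_inv_one_add_mem_Icc hX ha hsupp).1]
  obtain ⟨l, hl, hle⟩ := exists_tendsto_integral_logPerron_div hindep hident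
    (uniformlyComparable_clampedM_of_ae_mem ha hsupp) (measurable_clampedM a b)
  refine ⟨2 * l, (hl.const_mul 2).congr fun n => ?_, ?_⟩
  · rw [integral_Y hident ha hsupp]
    ring
  · rw [log_LambdaPlus_div_LambdaMinus hγ, inv_inv, ← hmean]
    linarith

theorem ae_tendsto_Y {l : ℝ}
    (hl : Tendsto (fun n : ℕ => ∫ ω, Y (fun i => X i ω) n ∂P) atTop (𝓝 l)) :
    ∀ᵐ ω ∂P, Tendsto (fun n : ℕ => Y (fun i => X i ω) n) atTop (𝓝 l) := by
  obtain ⟨σ, hσ, hsub⟩ := exists_hasSubgaussianMGF_Y hindep hident ha hsupp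
  filter_upwards [ae_tendsto_zero_of_hasSubgaussianMGF_div hσ hsub] with ω hω
  simpa only [sub_add_cancel, zero_add] using hω.add hl

theorem exists_concentration_Y :
    ∃ C : ℝ, 0 < C ∧ ∀ n : ℕ, 1 ≤ n → ∀ ε : ℝ, 0 < ε →
      P.real {ω | Y (fun i => X i ω) n - ∫ ω', Y (fun i => X i ω') n ∂P > ε}
        ≤ Real.exp (-C * ε ^ 2 * n) ∧
      P.real {ω | Y (fun i => X i ω) n - ∫ ω', Y (fun i => X i ω') n ∂P < -ε}
        ≤ Real.exp (-C * ε ^ 2 * n) := by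
  obtain ⟨σ, hσ, hsub⟩ := exists_hasSubgaussianMGF_Y hindep hident ha hsupp
  refine ⟨1 / (2 * σ), by positivity, fun n _ ε hε => ⟨?_, ?_⟩⟩
  · refine (measureReal_mono fun ω (hω : ε < _) => ?_).trans
      (measureReal_ge_le_of_hasSubgaussianMGF_div (hsub n) hε.le)
    exact hω.le
  · refine (measureReal_mono fun ω (hω : _ < -ε) => ?_).trans
      (measureReal_le_neg_le_of_hasSubgaussianMGF_div (hsub n) hε.le)
    exact hω.le

theorem ae_tendsto_mean_log_one_add :
    ∀ᵐ ω ∂P, Tendsto (fun n : ℕ => (1 / (n : ℝ)) * ∑ i ∈ Finset.range n, Real.log (1 + X i ω))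
      atTop (𝓝 (∫ ω, Real.log (1 + X 0 ω) ∂P)) := by
  have hlog : Measurable fun x : ℝ => Real.log (1 + x) := by fun_prop
  simpa only [smul_eq_mul, one_div] using
    strong_law_ae (fun i ω => Real.log (1 + X i ω))
      (integrable_log_one_add (hident 0).aemeasurable_fst ha hsupp)
      (fun i j hij => (hindep.indepFun hij).comp hlog hlog) fun i => (hident i).comp hlog

theorem ae_tendsto_log_eigMax_prodM {l : ℝ}
    (hl : ∀ᵐ ω ∂P, Tendsto (fun n : ℕ => Y (fun i => X i ω) n) atTop (𝓝 l)) :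
    ∀ᵐ ω ∂P, Tendsto (fun n : ℕ => (1 / (n : ℝ)) * Real.log (eigMax (prodM (fun i => X i ω) n)))
      atTop (𝓝 (∫ ω, Real.log (1 + X 0 ω) ∂P + l / 2)) := by
  filter_upwards [ae_forall_mem_of_identDistrib measurableSet_Icc hident hsupp,
    ae_tendsto_mean_log_one_add hindep hident ha hsupp, hl] with ω hω hslln hY
  refine (hslln.add (hY.div_const 2)).congr fun n => ?_
  rw [log_eigMax_prodM ha hω, Y_eq_two_div_mul_logPerron ha hω]
  ring

theorem ae_tendsto_log_eigMin_prodM {l : ℝ}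
    (hl : ∀ᵐ ω ∂P, Tendsto (fun n : ℕ => Y (fun i => X i ω) n) atTop (𝓝 l)) :
    ∀ᵐ ω ∂P, Tendsto (fun n : ℕ => (1 / (n : ℝ)) * Real.log (eigMin (prodM (fun i => X i ω) n)))
      atTop (𝓝 (∫ ω, Real.log (1 + X 0 ω) ∂P - l / 2)) := by
  filter_upwards [ae_forall_mem_of_identDistrib measurableSet_Icc hident hsupp,
    ae_tendsto_mean_log_one_add hindep hident ha hsupp, hl] with ω hω hslln hY
  refine (hslln.sub (hY.div_const 2)).congr fun n => ?_
  rw [log_eigMin_prodM ha hω, Y_eq_two_div_mul_logPerron ha hω]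
  ring

end RandomTransferProduct

end TransferMatrix

open TransferMatrix in
theorem mainTheorem3_general {Ω : Type*} [MeasurableSpace Ω] (P : Measure Ω)
    [IsProbabilityMeasure P] {a b : ℝ} (ha : -1 < a) (X : ℕ → Ω → ℝ) (hindep : iIndepFun X P)
    (hident : ∀ i, IdentDistrib (X i) (X 0) P P)
    (hsupp : ∀ᵐ ω ∂P, X 0 ω ∈ Set.Icc a b) :
    (∀ᵐ ω ∂P, ∀ n : ℕ,
      IsGreatest (spectrum ℝ (prodM (fun i => X i ω) n))
        (eigMax (prodM (fun i => X i ω) n)) ∧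
      IsLeast (spectrum ℝ (prodM (fun i => X i ω) n))
        (eigMin (prodM (fun i => X i ω) n)) ∧
      0 < eigMin (prodM (fun i => X i ω) n)) ∧
    (∀ n : ℕ, Integrable (fun ω => Y (fun i => X i ω) n) P) ∧
    (∃ C : ℝ, 0 < C ∧ ∀ n : ℕ, 1 ≤ n → ∀ ε : ℝ, 0 < ε →
      P.real {ω | Y (fun i => X i ω) n
          - ∫ ω', Y (fun i => X i ω') n ∂P > ε}
        ≤ Real.exp (-C * ε ^ 2 * n) ∧
      P.real {ω | Y (fun i => X i ω) n
          - ∫ ω', Y (fun i => X i ω') n ∂P < -ε}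
        ≤ Real.exp (-C * ε ^ 2 * n)) ∧
    (∃ Lplus Lminus : ℝ,
      (∀ᵐ ω ∂P, Tendsto (fun n : ℕ => (1 / (n : ℝ)) *
        Real.log (eigMax (prodM (fun i => X i ω) n)))
        atTop (𝓝 Lplus)) ∧
      (∀ᵐ ω ∂P, Tendsto (fun n : ℕ => (1 / (n : ℝ)) *
        Real.log (eigMin (prodM (fun i => X i ω) n)))
        atTop (𝓝 Lminus)) ∧
      Integrable (fun ω => Real.log (1 + X 0 ω)) P ∧
      Lplus + Lminus = 2 * ∫ ω, Real.log (1 + X 0 ω) ∂P ∧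
      (∀ᵐ ω ∂P, Tendsto (fun n : ℕ => Y (fun i => X i ω) n)
        atTop (𝓝 (Lplus - Lminus))) ∧
      Tendsto (fun n : ℕ => ∫ ω, Y (fun i => X i ω) n ∂P)
        atTop (𝓝 (Lplus - Lminus)) ∧
      Integrable (fun ω => (1 + X 0 ω)⁻¹) P ∧
      (∫ ω, (1 + X 0 ω)⁻¹ ∂P)⁻¹ ∈ Set.Icc (1 + a) (1 + b) ∧
      Lplus - Lminus ≤
        Real.log (LambdaPlus ((∫ ω, (1 + X 0 ω)⁻¹ ∂P)⁻¹) /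
          LambdaMinus ((∫ ω, (1 + X 0 ω)⁻¹ ∂P)⁻¹))) := by
  have hX := (hident 0).aemeasurable_fst
  have hmem := ae_forall_mem_of_identDistrib measurableSet_Icc hident hsupp
  obtain ⟨l, hmean, hle⟩ := exists_tendsto_integral_Y hindep hident ha hsupp
  have hY := ae_tendsto_Y hindep hident ha hsupp hmean
  set E := ∫ ω, Real.log (1 + X 0 ω) ∂P
  have hdiff : E + l / 2 - (E - l / 2) = l := by ring
  refine ⟨?_, integrable_Y hindep hident ha hsupp,
    exists_concentration_Y hindep hident ha hsupp, E + l / 2, E - l / 2,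
    ae_tendsto_log_eigMax_prodM hindep hident ha hsupp hY,
    ae_tendsto_log_eigMin_prodM hindep hident ha hsupp hY,
    integrable_log_one_add hX ha hsupp, by ring, by rwa [hdiff], by rwa [hdiff],
    integrable_inv_one_add hX ha hsupp, inv_integral_inv_one_add_mem_Icc hX ha hsupp,
    by rwa [hdiff]⟩
  filter_upwards [hmem] with ω hω n
  have hreal := four_mul_det_le_trace_sq (prodM_nonneg ha hω n)
  exact ⟨isGreatest_eigMax hreal, isLeast_eigMin hreal, eigMin_prodM_pos ha hω n⟩

theorem mainTheorem3 {Ω : Type*} [MeasurableSpace Ω] (P : Measure Ω) [IsProbabilityMeasure P]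
    (X : ℕ → Ω → ℝ) (hmeas : ∀ i, Measurable (X i)) (hindep : iIndepFun X P)
    (hident : ∀ i, IdentDistrib (X i) (X 0) P P)
    (hsupp : ∀ᵐ ω ∂P, X 0 ω ∈ Set.Icc (1 / 2 : ℝ) 1) :
    -- the extreme eigenvalues exist and are positive, and `Y_n` is integrable
    (∀ᵐ ω ∂P, ∀ n : ℕ,
      IsGreatest (spectrum ℝ (TransferMatrix.prodM (fun i => X i ω) n))
        (TransferMatrix.eigMax (TransferMatrix.prodM (fun i => X i ω) n)) ∧
      IsLeast (spectrum ℝ (TransferMatrix.prodM (fun i => X i ω) n))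
        (TransferMatrix.eigMin (TransferMatrix.prodM (fun i => X i ω) n)) ∧
      0 < TransferMatrix.eigMin (TransferMatrix.prodM (fun i => X i ω) n)) ∧
    (∀ n : ℕ, Integrable (fun ω => TransferMatrix.Y (fun i => X i ω) n) P) ∧
    -- concentration
    (∃ C : ℝ, 0 < C ∧ ∀ n : ℕ, 1 ≤ n → ∀ ε : ℝ, 0 < ε →
      P.real {ω | TransferMatrix.Y (fun i => X i ω) n
          - ∫ ω', TransferMatrix.Y (fun i => X i ω') n ∂P > ε}
        ≤ Real.exp (-C * ε ^ 2 * n) ∧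
      P.real {ω | TransferMatrix.Y (fun i => X i ω) n
          - ∫ ω', TransferMatrix.Y (fun i => X i ω') n ∂P < -ε}
        ≤ Real.exp (-C * ε ^ 2 * n)) ∧
    -- the almost sure, constant limits, their sum, and the bound on their difference
    (∃ Lplus Lminus : ℝ,
      (∀ᵐ ω ∂P, Tendsto (fun n : ℕ => (1 / (n : ℝ)) *
        Real.log (TransferMatrix.eigMax (TransferMatrix.prodM (fun i => X i ω) n)))
        atTop (𝓝 Lplus)) ∧
      (∀ᵐ ω ∂P, Tendsto (fun n : ℕ => (1 / (n : ℝ)) *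
        Real.log (TransferMatrix.eigMin (TransferMatrix.prodM (fun i => X i ω) n)))
        atTop (𝓝 Lminus)) ∧
      Integrable (fun ω => Real.log (1 + X 0 ω)) P ∧
      Lplus + Lminus = 2 * ∫ ω, Real.log (1 + X 0 ω) ∂P ∧
      (∀ᵐ ω ∂P, Tendsto (fun n : ℕ => TransferMatrix.Y (fun i => X i ω) n)
        atTop (𝓝 (Lplus - Lminus))) ∧
      Tendsto (fun n : ℕ => ∫ ω, TransferMatrix.Y (fun i => X i ω) n ∂P)
        atTop (𝓝 (Lplus - Lminus)) ∧
      Integrable (fun ω => (1 + X 0 ω)⁻¹) P ∧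
      (∫ ω, (1 + X 0 ω)⁻¹ ∂P)⁻¹ ∈ Set.Icc (3 / 2 : ℝ) 2 ∧
      Lplus - Lminus ≤
        Real.log (TransferMatrix.LambdaPlus ((∫ ω, (1 + X 0 ω)⁻¹ ∂P)⁻¹) /
          TransferMatrix.LambdaMinus ((∫ ω, (1 + X 0 ω)⁻¹ ∂P)⁻¹))) := by
  simpa only [show (1 + 1 / 2 : ℝ) = 3 / 2 by norm_num, one_add_one_eq_two] using
    mainTheorem3_general P (by norm_num) X hindep hident hsupp
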